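/- Let $p,q$ be positive integers with $\gcd(p,q)=1$ and $\frac pq<\frac12$, let $R>0$, and put $\vartheta=\frac pq\cdot 2\pi$. Consider a billiard ball that starts at a point $P_0$ of the boundary circle of a disc of radius $R$ with unit velocity, directed into the disc on the counterclockwise side so as to make the angle $\alpha=\frac{\pi-\vartheta}{2}$ with the inner normal at $P_0$ (so that consecutive scattering points are seen from the centre at the angle $\vartheta$). It moves along straight lines inside the disc and is reflected elastically at the circle (the angle of incidence equals the angle of reflection). Then the ball returns to $P_0$ with its initial velocity (just after reflection) after exactly $q$ reflections, and does not return to $P_0$ at any earlier reflection; and the $q$ straight paths of this closed trajectory divide the disc into exactly $$f_{\mathrm{total}}=pq+1$$ regions, i.e. the open disc minus the trajectory has exactly $pq+1$ connected components. Moreover, in the planar graph drawn by the circle and the trajectory, let the vertices be the scattering points on the circle together with all points in which two different straight paths of the trajectory meet, and let the edges be the connected components of the drawing (the circle together with the trajectory) minus the vertices. Then the number of vertices is $v=pq$ and the number of edges is $e=2pq$, and the number of regions agrees with Euler's formula (the exterior of the circle not counted): $f_{\mathrm{total}}=1+e-v$. -/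

import Mathlib

namespace CircularBilliard

/-- One step of the billiard flow in the disc of radius `R` centred at the origin of the plane.
A state `(x, v)` is a boundary point `x` together with the velocity `v` with which the ball leaves
`x`. The ball moves along a straight line to the next boundary point `y`, and there its velocity is
reflected in the tangent line of the circle at `y`, so that the incident and the reflected angle
with respect to the normal agree. -/
noncomputable def bounce (R : ℝ) (s : ℂ × ℂ) : ℂ × ℂ :=
  let y : ℂ := (EuclideanGeometry.Sphere.mk (0 : ℂ) R).secondInter s.1 s.2
  (y, (Submodule.span ℝ {y})ᗮ.reflection s.2)

/-- The unit velocity at the boundary point `P₀` which makes the angle `α = (π - ϑ) / 2` with the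
inner normal `-P₀ / ‖P₀‖`, on the counterclockwise side. -/
noncomputable def launchVelocity (P₀ : ℂ) (ϑ : ℝ) : ℂ :=
  -(P₀ / (‖P₀‖ : ℂ)) * Complex.exp (-(((Real.pi - ϑ) / 2 : ℝ) : ℂ) * Complex.I)

/-- The state of the ball immediately after `n` reflections. -/
noncomputable def state (R : ℝ) (P₀ : ℂ) (ϑ : ℝ) (n : ℕ) : ℂ × ℂ :=
  (bounce R)^[n] (P₀, launchVelocity P₀ ϑ)

/-- The `n`-th scattering point on the circle (the starting point `P₀` for `n = 0`). -/
noncomputable def point (R : ℝ) (P₀ : ℂ) (ϑ : ℝ) (n : ℕ) : ℂ :=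
  (state R P₀ ϑ n).1

/-- The straight path between the `k`-th and the `(k+1)`-st scattering point. -/
noncomputable def path (R : ℝ) (P₀ : ℂ) (ϑ : ℝ) (k : ℕ) : Set ℂ :=
  segment ℝ (point R P₀ ϑ k) (point R P₀ ϑ (k + 1))

/-- The part of the disc traced out by the ball up to its `n`-th scattering. -/
noncomputable def trajectory (R : ℝ) (P₀ : ℂ) (ϑ : ℝ) (n : ℕ) : Set ℂ :=
  ⋃ k < n, path R P₀ ϑ k

/-- The number of regions into which the disc is divided after `n` scatterings: the number of
connected components of the open disc minus the trajectory. -/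
noncomputable def numRegions (R : ℝ) (P₀ : ℂ) (ϑ : ℝ) (n : ℕ) : ℕ :=
  Nat.card (ConnectedComponents ↥(Metric.ball (0 : ℂ) R \ trajectory R P₀ ϑ n))

/-- The vertices of the planar graph drawn by the circle and the first `n` paths: the scattering
points on the circle and all points in which two different paths meet. -/
noncomputable def vertices (R : ℝ) (P₀ : ℂ) (ϑ : ℝ) (n : ℕ) : Set ℂ :=
  {z | ∃ k ≤ n, z = point R P₀ ϑ k} ∪
  {z | ∃ j < n, ∃ k < n, path R P₀ ϑ j ≠ path R P₀ ϑ k ∧ z ∈ path R P₀ ϑ j ∩ path R P₀ ϑ k}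

/-- The number of edges of this planar graph: the number of connected components that remain of
the drawing, i.e. of the circle together with the first `n` paths, when the vertices are removed. -/
noncomputable def numEdges (R : ℝ) (P₀ : ℂ) (ϑ : ℝ) (n : ℕ) : ℕ :=
  Nat.card (ConnectedComponents
    ↥((Metric.sphere (0 : ℂ) R ∪ trajectory R P₀ ϑ n) \ vertices R P₀ ϑ n))

/-- The number of vertices of this planar graph. -/
noncomputable def numVertices (R : ℝ) (P₀ : ℂ) (ϑ : ℝ) (n : ℕ) : ℕ :=
  (vertices R P₀ ϑ n).ncard

end CircularBilliard

/-! Each bounce rotates the state by `ϑ` (`bounce_eq`), so every path is a chord at distance `R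
cos(πp/q)` from the centre. Since `p` is invertible modulo `q`, the `q` paths are all the chords
with normals in the equally spaced directions `2πj/q`, measured from the normal of the first path
(`trajectory_eq`).

In the annulus between the circle touching all chords and the boundary, use coordinates `(a, s)`
with `0 ≤ s ≤ p`: direction `πa/q`, distance `R cos(πp/q) / cos(πs/q)`. With `a` taken modulo `2q`,
chord `j` is `|a - 2j| = s`, and `|a - 2j| < s` is its side away from the centre
(`lt_height_polarPoint_iff`). The arrangement becomes a grid of diagonals in a strip, and the counts
are combinatorial.

Regions: the chords separating a point from the centre form a run of at most `p` consecutive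
residues. There are `pq` nonempty runs, and the empty run gives the central region; each run belongs
to one convex nonempty cell. Vertices: chords `j` and `j + d` meet at `(2j + d, d)`, `1 ≤ d ≤ p`,
where `d = p` gives the scattering points; hence `pq`. Edges: a chord is cut at the nonzero integers
in `[-p, p]` into `2p - 1` pieces and the circle into `q` arcs; `q(2p - 1) + q = 2pq`.
`card_connectedComponents_of_partition` turns such partitions into component counts. -/

namespace CircularBilliard

/-! ### The billiard map as a rotation -/

/-- One billiard step rotates the boundary point and the velocity by the angle `ϑ`. -/
theorem bounce_eq {R : ℝ} (hR : 0 < R) {x : ℂ} (hx : ‖x‖ = R) (ϑ : ℝ) :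
    bounce R (x, x / R * (Complex.I * Complex.exp ((ϑ / 2 : ℝ) * Complex.I))) =
      (x * Complex.exp (ϑ * Complex.I),
        x * Complex.exp (ϑ * Complex.I) / R *
          (Complex.I * Complex.exp ((ϑ / 2 : ℝ) * Complex.I))) := by
  have hRc : (R : ℂ) ≠ 0 := by exact_mod_cast hR.ne'
  set C := Real.cos (ϑ / 2) with hC
  set S := Real.sin (ϑ / 2) with hS
  have hCS : C ^ 2 + S ^ 2 = 1 := Real.cos_sq_add_sin_sq _
  have hCSc : (C : ℂ) ^ 2 + (S : ℂ) ^ 2 = 1 := by exact_mod_cast hCS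
  have hI := Complex.I_sq
  have hE : Complex.exp ((ϑ / 2 : ℝ) * Complex.I) = C + S * Complex.I := by
    rw [Complex.exp_mul_I, ← Complex.ofReal_cos, ← Complex.ofReal_sin]
  have hE2 : Complex.exp (ϑ * Complex.I) = (C + S * Complex.I) ^ 2 := by
    rw [← hE, ← Complex.exp_nat_mul]
    congr 1
    push_cast
    ring
  have hxx : x.re ^ 2 + x.im ^ 2 = R ^ 2 := by
    rw [← hx, ← Complex.normSq_eq_norm_sq, Complex.normSq_apply]
    ring
  rw [hE, hE2]
  set v : ℂ := x / R * (Complex.I * (C + S * Complex.I)) with hv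
  have hvre : v.re = (x.re * (-S) - x.im * C) / R := by
    have : v = ((x * (Complex.I * (C + S * Complex.I))) / R) := by rw [hv]; ring
    rw [this, Complex.div_ofReal_re]
    simp
  have hvim : v.im = (x.re * C - x.im * S) / R := by
    have : v = ((x * (Complex.I * (C + S * Complex.I))) / R) := by rw [hv]; ring
    rw [this, Complex.div_ofReal_im]
    simp
    ring
  have hvx : inner ℝ v x = -R * S := by
    rw [Complex.inner]
    simp only [Complex.mul_re, Complex.conj_re, Complex.conj_im]
    rw [hvre, hvim]
    field_simp
    linear_combination -S * hxx
  have hvv : inner ℝ v v = 1 := by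
    rw [Complex.inner]
    simp only [Complex.mul_re, Complex.conj_re, Complex.conj_im]
    rw [hvre, hvim]
    field_simp
    linear_combination (C ^ 2 + S ^ 2) * hxx + R ^ 2 * hCS
  -- The chord has length `2RS`, so the next boundary point is `x + 2RS v`, which equals `x (C + S
  -- i)²`.
  have hy : (EuclideanGeometry.Sphere.mk (0 : ℂ) R).secondInter x v =
      x * (C + S * Complex.I) ^ 2 := by
    unfold EuclideanGeometry.Sphere.secondInter
    simp only [vsub_eq_sub, sub_zero, vadd_eq_add, hvx, hvv, Complex.real_smul]
    rw [hv]
    push_cast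
    field_simp
    linear_combination (-x) * hCSc + (S ^ 2 * x) * hI
  set y : ℂ := x * (C + S * Complex.I) ^ 2 with hyd
  have hny : ‖y‖ = R := by
    rw [hyd, ← hE2, norm_mul, Complex.norm_exp_ofReal_mul_I, hx, mul_one]
  have hyv : inner ℝ y v = R * S := by
    have h1 : y = x + ((2 * R * S : ℝ)) • v := by
      rw [Complex.real_smul, hyd, hv]
      push_cast
      field_simp
      linear_combination x * hCSc - (S ^ 2 * x) * hI
    rw [h1, inner_add_left, inner_smul_left, hvv, real_inner_comm, hvx]
    simp
    ring
  unfold bounce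
  simp only [hy]
  refine Prod.ext rfl ?_
  simp only
  rw [Submodule.reflection_orthogonal_apply, Submodule.reflection_singleton_apply, hyv, hny]
  simp only [Complex.real_smul, nsmul_eq_mul, RCLike.ofReal_real_eq_id, id]
  rw [hyd, hv]
  push_cast
  field_simp
  linear_combination (-x * (C + S * Complex.I) * Complex.I ) * hCSc
    + (x * (-3 * C * S ^ 2 * Complex.I - 2 * C ^ 2 * S - S ^ 3 * Complex.I ^ 2)) * hI

theorem state_eq {R : ℝ} (hR : 0 < R) {P₀ : ℂ} (hP : ‖P₀‖ = R) (ϑ : ℝ) (n : ℕ) :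
    state R P₀ ϑ n = (P₀ * Complex.exp ((n * ϑ : ℝ) * Complex.I),
      P₀ * Complex.exp ((n * ϑ : ℝ) * Complex.I) / R *
        (Complex.I * Complex.exp ((ϑ / 2 : ℝ) * Complex.I))) := by
  induction n with
  | zero =>
    have : launchVelocity P₀ ϑ =
        P₀ / R * (Complex.I * Complex.exp ((ϑ / 2 : ℝ) * Complex.I)) := by
      have h1 : -(((Real.pi - ϑ) / 2 : ℝ) : ℂ) * Complex.I =
          (ϑ / 2 : ℝ) * Complex.I - (Real.pi / 2 * Complex.I) := by
        push_cast
        ring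
      rw [launchVelocity, hP, h1, Complex.exp_sub, Complex.exp_pi_div_two_mul_I]
      field_simp
      rw [Complex.I_sq]
      ring
    simp [state, this]
  | succ n ih =>
    have h1 : state R P₀ ϑ (n + 1) = bounce R (state R P₀ ϑ n) :=
      Function.iterate_succ_apply' _ _ _
    have h2 : Complex.exp (((n + 1 : ℕ) * ϑ : ℝ) * Complex.I) =
        Complex.exp ((n * ϑ : ℝ) * Complex.I) * Complex.exp (ϑ * Complex.I) := by
      rw [← Complex.exp_add]
      congr 1
      push_cast
      ring
    rw [h1, ih, bounce_eq hR (by rw [norm_mul, Complex.norm_exp_ofReal_mul_I, hP, mul_one]), h2,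
      mul_assoc P₀]

theorem point_eq {R : ℝ} (hR : 0 < R) {P₀ : ℂ} (hP : ‖P₀‖ = R) (ϑ : ℝ) (n : ℕ) :
    point R P₀ ϑ n = P₀ * Complex.exp ((n * ϑ : ℝ) * Complex.I) := by
  rw [point, state_eq hR hP]

/-! ### Counting connected components -/

/-- A set that is partitioned into finitely many connected, relatively closed pieces has as many
connected components as there are pieces. -/
theorem card_connectedComponents_of_partition {X ι : Type*} [TopologicalSpace X] [Finite ι]
    {S : Set X} (A K : ι → Set X) (hS : S = ⋃ i, A i) (hne : ∀ i, (A i).Nonempty)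
    (hconn : ∀ i, IsPreconnected (A i)) (hK : ∀ i, IsClosed (K i)) (hAK : ∀ i, A i ⊆ K i)
    (hKS : ∀ i, K i ∩ S ⊆ A i) (hdisj : ∀ i j, i ≠ j → Disjoint (A i) (A j)) :
    Nat.card (ConnectedComponents ↥S) = Nat.card ι := by
  have hAS : ∀ i, A i ⊆ S := fun i => hS ▸ Set.subset_iUnion A i
  have hmem : ∀ x : S, ∃ i, (x : X) ∈ A i := fun x => by
    have : (x : X) ∈ ⋃ i, A i := hS ▸ x.2
    exact Set.mem_iUnion.1 this
  choose f hf using hmem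
  have huniq : ∀ (x : S) i, (x : X) ∈ A i → f x = i := fun x i hi => by
    by_contra hne
    exact Set.disjoint_left.1 (hdisj _ _ hne) (hf x) hi
  have hpre : ∀ i, f ⁻¹' {i} = ((↑) : S → X) ⁻¹' K i := fun i => by
    ext x
    constructor
    · rintro rfl
      exact hAK _ (hf x)
    · exact fun h => huniq x i (hKS i ⟨h, x.2⟩)
  -- With discrete `ι`, closed fibres and finiteness make the index map `f` continuous; its fibres
  -- are connected, so it is a bijection on components.
  let : TopologicalSpace ι := ⊥
  have : DiscreteTopology ι := ⟨rfl⟩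
  have hcont : Continuous f := by
    rw [continuous_iff_isClosed]
    intro t _
    rw [← Set.biUnion_preimage_singleton]
    refine (Set.toFinite t).isClosed_biUnion fun i _ => ?_
    rw [hpre i]
    exact (hK i).preimage continuous_subtype_val
  have hA : ∀ i, ((↑) : S → X) '' (f ⁻¹' {i}) = A i := fun i => by
    ext x
    constructor
    · rintro ⟨y, rfl, rfl⟩
      exact hf y
    · exact fun hx => ⟨⟨x, hAS i hx⟩, huniq ⟨x, hAS i hx⟩ i hx, rfl⟩
  refine Nat.card_congr (Equiv.ofBijective hcont.connectedComponentsLift ⟨?_, ?_⟩)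
  · intro a b
    obtain ⟨x, rfl⟩ := ConnectedComponents.surjective_coe a
    obtain ⟨y, rfl⟩ := ConnectedComponents.surjective_coe b
    intro hxy
    simp only [Continuous.connectedComponentsLift_apply_coe] at hxy
    have hp : IsPreconnected (f ⁻¹' {f y}) := by
      rw [← Topology.IsInducing.subtypeVal.isPreconnected_image, hA]
      exact hconn _
    rw [ConnectedComponents.coe_eq_coe]
    exact (connectedComponent_eq (hp.subset_connectedComponent (x := x) hxy rfl))
  · intro i
    obtain ⟨x, hx⟩ := hne i
    exact ⟨ConnectedComponents.mk ⟨x, hAS i hx⟩, huniq ⟨x, hAS i hx⟩ i hx⟩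

/-! ### Polar coordinates adapted to the chords -/

/-- The point of the circle through `c` that is seen at the angle `π a / q` from `c`. -/
noncomputable def ray (q : ℕ) (c : ℂ) (a : ℝ) : ℂ :=
  c * Complex.exp ((Real.pi * a / q : ℝ) * Complex.I)

/-- The point in the direction `π a / q` whose distance from the centre is that of the point at
angle `π s / q` from the foot of a chord of half-angle `π p / q`. -/
noncomputable def polarPoint (p q : ℕ) (c : ℂ) (a s : ℝ) : ℂ :=
  ray q c a * ((Real.cos (Real.pi * p / q) / Real.cos (Real.pi * s / q) : ℝ) : ℂ)

/-- The coordinate of `z` along the normal of the `j`-th chord. -/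
noncomputable def height (q : ℕ) (c : ℂ) (j : ℤ) (z : ℂ) : ℝ :=
  (z / ray q c (2 * j)).re

/-- The chord of half-angle `π p / q` whose normal has direction `2 π j / q`. -/
def chord (p q : ℕ) (c : ℂ) (j : ℤ) : Set ℂ :=
  (fun s : ℝ => polarPoint p q c (2 * j + s) s) '' Set.Icc (-p : ℝ) p

variable {p q : ℕ} {c : ℂ}

theorem ray_ne_zero (hc : c ≠ 0) (a : ℝ) : ray q c a ≠ 0 :=
  mul_ne_zero hc (Complex.exp_ne_zero _)

theorem norm_ray (a : ℝ) : ‖ray q c a‖ = ‖c‖ := by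
  rw [ray, norm_mul, Complex.norm_exp_ofReal_mul_I, mul_one]

theorem ray_add (a b : ℝ) :
    ray q c (a + b) = ray q c a * Complex.exp ((Real.pi * b / q : ℝ) * Complex.I) := by
  rw [ray, ray, mul_assoc, ← Complex.exp_add]
  congr 2
  push_cast
  ring

theorem ray_eq_ray_iff (hc : c ≠ 0) (hq : 0 < q) {a b : ℝ} :
    ray q c a = ray q c b ↔ ∃ n : ℤ, a = b + 2 * q * n := by
  have hq' : (q : ℂ) ≠ 0 := by exact_mod_cast hq.ne'
  have hπ : (Real.pi : ℂ) ≠ 0 := by exact_mod_cast Real.pi_ne_zero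
  rw [ray, ray, mul_right_inj' hc, Complex.exp_eq_exp_iff_exists_int]
  refine exists_congr fun n => ?_
  have h1 : (↑(Real.pi * b / q : ℝ) : ℂ) * Complex.I + n * (2 * Real.pi * Complex.I) =
      ((Real.pi * (b + 2 * q * n) / q : ℝ) : ℂ) * Complex.I := by
    push_cast
    field_simp
  rw [h1, mul_left_inj' Complex.I_ne_zero, Complex.ofReal_inj]
  have hq'' : (q : ℝ) ≠ 0 := by exact_mod_cast hq.ne'
  rw [div_left_inj' hq'', mul_right_inj' Real.pi_ne_zero]

theorem angle_mem (hlt : 2 * p < q) {s : ℝ} (hs : |s| ≤ p) :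
    |Real.pi * s / q| < Real.pi / 2 := by
  have hq : (0 : ℝ) < q := by exact_mod_cast (by omega : 0 < q)
  have hlt' : (2 : ℝ) * p < q := by exact_mod_cast hlt
  rw [abs_div, abs_mul, abs_of_pos Real.pi_pos, abs_of_pos hq, div_lt_div_iff₀ hq two_pos]
  nlinarith [Real.pi_pos]

theorem cos_angle_pos (hlt : 2 * p < q) {s : ℝ} (hs : |s| ≤ p) :
    0 < Real.cos (Real.pi * s / q) := by
  have := abs_lt.1 (angle_mem hlt hs)
  exact Real.cos_pos_of_mem_Ioo ⟨by linarith [this.1], this.2⟩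

theorem cos_half_pos (hlt : 2 * p < q) : 0 < Real.cos (Real.pi * p / q) :=
  cos_angle_pos hlt (s := p) (by simp)

theorem polarPoint_add_two_mul (hc : c ≠ 0) (hq : 0 < q) (a s : ℝ) (n : ℤ) :
    polarPoint p q c (a + 2 * q * n) s = polarPoint p q c a s := by
  rw [polarPoint, polarPoint, (ray_eq_ray_iff hc hq).2 ⟨n, rfl⟩]

theorem polarPoint_neg (a s : ℝ) : polarPoint p q c a (-s) = polarPoint p q c a s := by
  rw [polarPoint, polarPoint, mul_neg, neg_div, Real.cos_neg]

theorem polarPoint_boundary (hlt : 2 * p < q) (a : ℝ) : polarPoint p q c a p = ray q c a := by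
  rw [polarPoint, div_self (cos_half_pos hlt).ne', Complex.ofReal_one, mul_one]

theorem norm_polarPoint (hlt : 2 * p < q) {a s : ℝ} (hs : |s| ≤ p) :
    ‖polarPoint p q c a s‖ = ‖c‖ * (Real.cos (Real.pi * p / q) / Real.cos (Real.pi * s / q)) := by
  rw [polarPoint, norm_mul, norm_ray, Complex.norm_real, Real.norm_of_nonneg]
  exact (div_pos (cos_half_pos hlt) (cos_angle_pos hlt hs)).le

theorem cos_abs_angle (s : ℝ) :
    Real.cos (Real.pi * s / q) = Real.cos (Real.pi * |s| / q) := by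
  rw [← Real.cos_abs, abs_div, abs_mul, abs_of_pos Real.pi_pos, Nat.abs_cast]

theorem cos_angle_lt_iff (hlt : 2 * p < q) {s t : ℝ} (hs : |s| ≤ p) (ht : |t| ≤ p) :
    Real.cos (Real.pi * s / q) < Real.cos (Real.pi * t / q) ↔ |t| < |s| := by
  have hq : (0 : ℝ) < q := by exact_mod_cast (by omega : 0 < q)
  have key : ∀ {x : ℝ}, |x| ≤ p → Real.pi * |x| / q ∈ Set.Icc 0 Real.pi := fun {x} hx => by
    have h1 := (abs_lt.1 (angle_mem hlt (s := |x|) (by rwa [abs_abs]))).2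
    exact ⟨by positivity, by linarith [Real.pi_pos]⟩
  rw [cos_abs_angle s, cos_abs_angle t, Real.strictAntiOn_cos.lt_iff_gt (key hs) (key ht),
    div_lt_div_iff_of_pos_right hq, mul_lt_mul_iff_right₀ Real.pi_pos]

/-- The distance from the centre determines `|s|`, since the cosine is strictly decreasing in `|s|`
on the admissible range; the direction then determines `a` modulo `2q`. -/
theorem polarPoint_eq_iff (hc : c ≠ 0) (hlt : 2 * p < q) {a b s t : ℝ} (hs : |s| ≤ p)
    (ht : |t| ≤ p) :
    polarPoint p q c a s = polarPoint p q c b t ↔ |s| = |t| ∧ ∃ n : ℤ, a = b + 2 * q * n := by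
  have hq : 0 < q := by omega
  constructor
  · intro h
    have hst : |s| = |t| := by
      have h1 := congrArg norm h
      rw [norm_polarPoint hlt hs, norm_polarPoint hlt ht, mul_right_inj' (norm_ne_zero_iff.2 hc),
        div_eq_div_iff (cos_angle_pos hlt hs).ne' (cos_angle_pos hlt ht).ne',
          mul_right_inj' (cos_half_pos hlt).ne'] at h1
      exact le_antisymm (not_lt.1 fun h2 => ((cos_angle_lt_iff hlt hs ht).2 h2).ne h1.symm)
        (not_lt.1 fun h2 => ((cos_angle_lt_iff hlt ht hs).2 h2).ne h1)
    refine ⟨hst, (ray_eq_ray_iff hc hq).1 ?_⟩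
    rw [polarPoint, polarPoint, cos_abs_angle s, cos_abs_angle t, hst] at h
    refine mul_right_cancel₀ ?_ h
    rw [← cos_abs_angle]
    exact_mod_cast (div_pos (cos_half_pos hlt) (cos_angle_pos hlt ht)).ne'
  · rintro ⟨hst, n, rfl⟩
    rw [polarPoint_add_two_mul hc hq, polarPoint, polarPoint, cos_abs_angle s, cos_abs_angle t, hst]

theorem exists_polarPoint (hc : c ≠ 0) (hlt : 2 * p < q) {z : ℂ}
    (h1 : ‖c‖ * Real.cos (Real.pi * p / q) ≤ ‖z‖) (h2 : ‖z‖ ≤ ‖c‖) :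
    ∃ a s : ℝ, 0 ≤ s ∧ s ≤ p ∧ z = polarPoint p q c a s := by
  have hq : (0 : ℝ) < q := by exact_mod_cast (by omega : 0 < q)
  have hκ := cos_half_pos hlt
  have hcn : 0 < ‖c‖ := norm_pos_iff.2 hc
  have hz : 0 < ‖z‖ := lt_of_lt_of_le (mul_pos hcn hκ) h1
  set ρ := ‖c‖ * Real.cos (Real.pi * p / q) / ‖z‖ with hρ
  have hρ1 : ρ ≤ 1 := (div_le_one hz).2 h1
  have hρ0 : 0 < ρ := div_pos (mul_pos hcn hκ) hz
  have hρκ : Real.cos (Real.pi * p / q) ≤ ρ := by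
    rw [hρ, le_div_iff₀ hz, mul_comm]
    exact mul_le_mul_of_nonneg_right h2 hκ.le
  have hpα := abs_lt.1 (angle_mem hlt (s := p) (by simp))
  refine ⟨q / Real.pi * Complex.arg (z / c), q / Real.pi * Real.arccos ρ,
    mul_nonneg (by positivity) (Real.arccos_nonneg _), ?_, ?_⟩
  · have h3 : Real.arccos ρ ≤ Real.pi * p / q := by
      rw [← Real.arccos_cos (x := Real.pi * p / q) (by positivity) (by linarith [Real.pi_pos])]
      exact Real.arccos_le_arccos hρκ
    calc (q : ℝ) / Real.pi * Real.arccos ρ ≤ q / Real.pi * (Real.pi * p / q) := by gcongr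
      _ = p := by field_simp [Real.pi_ne_zero]
  · have h4 : Real.pi * (q / Real.pi * Real.arccos ρ) / q = Real.arccos ρ := by
      field_simp [Real.pi_ne_zero]
    have h5 : Real.pi * (q / Real.pi * Complex.arg (z / c)) / q = Complex.arg (z / c) := by
      field_simp [Real.pi_ne_zero]
    have h6 : Real.cos (Real.pi * p / q) / ρ = ‖z / c‖ := by
      rw [hρ, norm_div]
      field_simp
    rw [polarPoint, ray, h4, h5, Real.cos_arccos (by linarith) hρ1, h6, mul_assoc,
      mul_comm (Complex.exp _), Complex.norm_mul_exp_arg_mul_I, mul_div_cancel₀ _ hc]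

/-- In the frame of the normal the first coordinate does not depend on `s`: this is why `s ↦
polarPoint (b + s) s` runs along a straight line. -/
theorem polarPoint_chord (hlt : 2 * p < q) (b : ℝ) {s : ℝ} (hs : |s| ≤ p) :
    polarPoint p q c (b + s) s = ray q c b *
      ⟨Real.cos (Real.pi * p / q), Real.cos (Real.pi * p / q) * Real.tan (Real.pi * s / q)⟩ := by
  have h := (cos_angle_pos hlt hs).ne'
  rw [polarPoint, ray_add, mul_assoc, Complex.exp_mul_I, ← Complex.ofReal_cos,
    ← Complex.ofReal_sin]
  congr 1
  rw [Real.tan_eq_sin_div_cos]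
  generalize Real.cos (Real.pi * s / q) = C at h ⊢
  generalize Real.cos (Real.pi * p / q) = κ
  generalize Real.sin (Real.pi * s / q) = S
  apply Complex.ext
  · rw [Complex.re_mul_ofReal]
    simp
    field_simp
  · rw [Complex.im_mul_ofReal]
    simp
    field_simp

theorem height_polarPoint (hc : c ≠ 0) (j : ℤ) (a s : ℝ) :
    height q c j (polarPoint p q c a s) = Real.cos (Real.pi * p / q) *
      Real.cos (Real.pi * (a - 2 * j) / q) / Real.cos (Real.pi * s / q) := by
  have h : ray q c a = ray q c (2 * j) *
      Complex.exp ((Real.pi * (a - 2 * j) / q : ℝ) * Complex.I) := by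
    rw [← ray_add]
    congr 1
    ring
  rw [height, polarPoint, h, mul_assoc, mul_div_cancel_left₀ _ (ray_ne_zero hc _),
    Complex.re_mul_ofReal, Complex.exp_ofReal_mul_I_re]
  ring

theorem abs_height_le (j : ℤ) (z : ℂ) : |height q c j z| ≤ ‖z‖ / ‖c‖ := by
  rw [height, ← norm_ray (q := q) (c := c) (2 * j), ← norm_div]
  exact Complex.abs_re_le_norm _

theorem mem_chord_iff (hc : c ≠ 0) (hlt : 2 * p < q) {j : ℤ} {z : ℂ} :
    z ∈ chord p q c j ↔ ‖z‖ ≤ ‖c‖ ∧ height q c j z = Real.cos (Real.pi * p / q) := by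
  have hq : (0 : ℝ) < q := by exact_mod_cast (by omega : 0 < q)
  have hκ := cos_half_pos hlt
  have hcn : 0 < ‖c‖ := norm_pos_iff.2 hc
  have hpα := abs_lt.1 (angle_mem hlt (s := p) (by simp))
  constructor
  · rintro ⟨s, hs, rfl⟩
    have hs' : |s| ≤ p := abs_le.2 hs
    constructor
    · simp only
      rw [norm_polarPoint hlt hs']
      refine mul_le_of_le_one_right hcn.le ((div_le_one (cos_angle_pos hlt hs')).2 ?_)
      refine not_lt.1 fun h => ?_
      rw [cos_angle_lt_iff hlt hs' (by simp)] at h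
      simp at h
      linarith
    · simp only
      rw [polarPoint_chord hlt _ hs', height, mul_div_cancel_left₀ _ (ray_ne_zero hc _)]
  · rintro ⟨h1, h2⟩
    set w := z / ray q c (2 * j) with hw
    have hre : w.re = Real.cos (Real.pi * p / q) := h2
    have hn : ‖w‖ ≤ 1 := by
      rw [hw, norm_div, norm_ray]
      exact (div_le_one hcn).2 h1
    have him : |w.im| ≤ Real.sin (Real.pi * p / q) := by
      refine abs_le_of_sq_le_sq ?_ ?_
      · have h3 : w.re * w.re + w.im * w.im ≤ 1 := by
          rw [← Complex.normSq_apply, Complex.normSq_eq_norm_sq]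
          exact pow_le_one₀ (norm_nonneg _) hn
        rw [hre] at h3
        nlinarith [Real.sin_sq_add_cos_sq (Real.pi * p / q)]
      · exact Real.sin_nonneg_of_nonneg_of_le_pi (by positivity) (by linarith [Real.pi_pos])
    have htan : |w.im / Real.cos (Real.pi * p / q)| ≤ Real.tan (Real.pi * p / q) := by
      rw [abs_div, abs_of_pos hκ, Real.tan_eq_sin_div_cos]
      gcongr
    have harctan : Real.arctan (Real.tan (Real.pi * p / q)) = Real.pi * p / q :=
      Real.arctan_tan (by linarith) hpα.2
    -- The parameter is recovered from the tangential coordinate `w.im = cos(πp/q) tan t`.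
    set t := Real.arctan (w.im / Real.cos (Real.pi * p / q)) with ht
    have ht1 : t ≤ Real.pi * p / q := by
      rw [← harctan]
      exact Real.arctan_strictMono.monotone (abs_le.1 htan).2
    have ht2 : -(Real.pi * p / q) ≤ t := by
      rw [← harctan, ← Real.arctan_neg]
      exact Real.arctan_strictMono.monotone (abs_le.1 htan).1
    have hst : Real.pi * (q / Real.pi * t) / q = t := by field_simp [Real.pi_ne_zero]
    have hp1 : (p : ℝ) = q / Real.pi * (Real.pi * p / q) := by field_simp [Real.pi_ne_zero]
    have hs : q / Real.pi * t ∈ Set.Icc (-p : ℝ) p := by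
      constructor
      · rw [hp1, ← mul_neg]
        gcongr
      · conv_rhs => rw [hp1]
        gcongr
    refine ⟨q / Real.pi * t, hs, ?_⟩
    simp only
    rw [polarPoint_chord hlt _ (abs_le.2 hs), hst, ht, Real.tan_arctan,
      mul_div_cancel₀ _ hκ.ne', ← hre, Complex.eta, hw, mul_div_cancel₀ _ (ray_ne_zero hc _)]

/-- A chord is convex as a disc cut by a line, so it contains the segment. Conversely `tan(πs/q)` is
an affine coordinate along it, from which the weights are read off. -/
theorem segment_ray (hp1 : 1 ≤ p) (hc : c ≠ 0) (hlt : 2 * p < q) (j : ℤ) :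
    segment ℝ (ray q c (2 * j - p)) (ray q c (2 * j + p)) = chord p q c j := by
  have h1 : ∀ x ∈ Set.Icc (-p : ℝ) p, polarPoint p q c (2 * j + x) x ∈ chord p q c j :=
    fun x hx => ⟨x, hx, rfl⟩
  have hp : (-p : ℝ) ≤ p := by linarith [(Nat.cast_nonneg p : (0 : ℝ) ≤ p)]
  have hconv : Convex ℝ (chord p q c j) := by
    have : chord p q c j = Metric.closedBall 0 ‖c‖ ∩
        {z | height q c j z = Real.cos (Real.pi * p / q)} := by
      ext z
      simp [mem_chord_iff hc hlt]
    rw [this]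
    refine (convex_closedBall _ _).inter (convex_hyperplane ?_ _)
    exact ⟨fun x y => by simp [height, add_div], fun r x => by
      simp [height, mul_div_assoc]⟩
  have e1 : ray q c (2 * j - p) = polarPoint p q c (2 * j + -p) (-p) := by
    rw [polarPoint_neg, polarPoint_boundary hlt, sub_eq_add_neg]
  have e2 : ray q c (2 * j + p) = polarPoint p q c (2 * j + p) p := (polarPoint_boundary hlt _).symm
  refine (Set.Subset.antisymm ?_ ?_)
  · refine hconv.segment_subset ?_ ?_
    · rw [e1]
      exact h1 _ ⟨le_rfl, hp⟩
    · rw [e2]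
      exact h1 _ ⟨hp, le_rfl⟩
  · rintro _ ⟨s, hs, rfl⟩
    have hs' : |s| ≤ p := abs_le.2 hs
    have hκ := cos_half_pos hlt
    simp only
    have hq : (0 : ℝ) < q := by exact_mod_cast (by omega : 0 < q)
    have ha := abs_lt.1 (angle_mem hlt hs')
    have hpα := abs_lt.1 (angle_mem hlt (s := p) (by simp))
    have hp' : (1 : ℝ) ≤ p := by exact_mod_cast hp1
    have hT : 0 < Real.tan (Real.pi * p / q) :=
      Real.tan_pos_of_pos_of_lt_pi_div_two (by positivity) hpα.2
    have hup : Real.tan (Real.pi * s / q) ≤ Real.tan (Real.pi * p / q) := by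
      refine Real.strictMonoOn_tan.monotoneOn ⟨by linarith, ha.2⟩ ⟨by linarith, hpα.2⟩ ?_
      gcongr
      exact hs.2
    have hlow : -Real.tan (Real.pi * p / q) ≤ Real.tan (Real.pi * s / q) := by
      rw [← Real.tan_neg, ← neg_div, ← mul_neg]
      refine Real.strictMonoOn_tan.monotoneOn ⟨?_, ?_⟩ ⟨by linarith, ha.2⟩ ?_
      · rw [mul_neg, neg_div]
        linarith
      · rw [mul_neg, neg_div]
        linarith
      · gcongr
        exact hs.1
    rw [e1, e2, polarPoint_chord hlt _ hs', polarPoint_chord hlt _ (by simp),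
      polarPoint_chord hlt _ (by simp), mul_neg, neg_div, Real.tan_neg]
    generalize Real.tan (Real.pi * p / q) = T at *
    generalize Real.tan (Real.pi * s / q) = t at *
    refine ⟨(1 - t / T) / 2, (1 + t / T) / 2, ?_, ?_, by ring, ?_⟩
    · have := (div_le_one hT).2 hup
      linarith
    · have : -1 ≤ t / T := by
        rw [le_div_iff₀ hT]
        linarith
      linarith
    · rw [Complex.real_smul, Complex.real_smul, mul_left_comm, mul_left_comm (_ : ℂ) (ray _ _ _),
        ← mul_add]
      congr 1
      apply Complex.ext
      · simp
        ring
      · simp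
        field_simp
        ring

/-- Some translate of `a` by a multiple of `2q` lies in `[-q, q]`, where the cosine is strictly
decreasing in the absolute value. -/
theorem cos_angle_cases (hq : 0 < q) {s : ℝ} (h0 : 0 ≤ s) (h1 : s ≤ q) (a : ℝ) :
    (Real.cos (Real.pi * s / q) < Real.cos (Real.pi * a / q) ↔ ∃ n : ℤ, |a - 2 * q * n| < s) ∧
    (Real.cos (Real.pi * s / q) ≤ Real.cos (Real.pi * a / q) ↔ ∃ n : ℤ, |a - 2 * q * n| ≤ s) := by
  have hq' : (0 : ℝ) < q := by exact_mod_cast hq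
  have hcos : ∀ n : ℤ, Real.cos (Real.pi * a / q) = Real.cos (Real.pi * |a - 2 * q * n| / q) :=
    fun n => by
    have : Real.pi * (a - 2 * q * n) / q = Real.pi * a / q - n * (2 * Real.pi) := by
      field_simp
    rw [← cos_abs_angle, this, Real.cos_sub_int_mul_two_pi]
  have hmem : ∀ {x : ℝ}, 0 ≤ x → x ≤ q → Real.pi * x / q ∈ Set.Icc 0 Real.pi := fun hx0 hx1 =>
    ⟨by positivity, by rw [div_le_iff₀ hq']; gcongr⟩
  have hround : |a - 2 * q * (round (a / (2 * q)) : ℤ)| ≤ q := by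
    have h := abs_sub_round (a / (2 * q))
    have h2 : a - 2 * q * (round (a / (2 * q)) : ℤ) =
        (2 * q) * (a / (2 * q) - round (a / (2 * q))) := by field_simp
    rw [h2, abs_mul, abs_of_pos (by positivity : (0 : ℝ) < 2 * q)]
    nlinarith
  have hlt : ∀ n : ℤ, |a - 2 * q * n| ≤ q →
      (Real.cos (Real.pi * s / q) < Real.cos (Real.pi * a / q) ↔ |a - 2 * q * n| < s) :=
    fun n hn => by
    rw [hcos n, Real.strictAntiOn_cos.lt_iff_gt (hmem h0 h1) (hmem (abs_nonneg _) hn),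
      div_lt_div_iff_of_pos_right hq', mul_lt_mul_iff_right₀ Real.pi_pos]
  have hle : ∀ n : ℤ, |a - 2 * q * n| ≤ q →
      (Real.cos (Real.pi * s / q) ≤ Real.cos (Real.pi * a / q) ↔ |a - 2 * q * n| ≤ s) :=
    fun n hn => by
    rw [hcos n, Real.strictAntiOn_cos.le_iff_ge (hmem h0 h1) (hmem (abs_nonneg _) hn),
      div_le_div_iff_of_pos_right hq', mul_le_mul_iff_right₀ Real.pi_pos]
  exact ⟨⟨fun h => ⟨_, (hlt _ hround).1 h⟩, fun ⟨n, hn⟩ => (hlt n (hn.le.trans h1)).2 hn⟩,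
    ⟨fun h => ⟨_, (hle _ hround).1 h⟩, fun ⟨n, hn⟩ => (hle n (hn.trans h1)).2 hn⟩⟩

/-! ### Regions -/

/-- The part of the disc that lies beyond exactly the chords with index in `U`. -/
def cell (p q : ℕ) (c : ℂ) (U : Set ℤ) : Set ℂ :=
  Metric.ball 0 ‖c‖ ∩ {z | ∀ j : ℤ,
    (j ∈ U → Real.cos (Real.pi * p / q) < height q c j z) ∧
    (j ∉ U → height q c j z < Real.cos (Real.pi * p / q))}

/-- The indices whose residue modulo `q` lies in `{i, …, i + m}`. -/
def arcIndices (q : ℕ) (i : ℤ) (m : ℕ) : Set ℤ :=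
  {j | ∃ n : ℤ, i ≤ j + q * n ∧ j + q * n ≤ i + m}

/-- The sets of chords that cut off some cell from the centre. -/
def cellIndices (p q : ℕ) : Option (Fin q × Fin p) → Set ℤ
  | none => ∅
  | some (i, m) => arcIndices q (i : ℕ) m

theorem arcIndices_add (i k : ℤ) (m : ℕ) : arcIndices q (i + q * k) m = arcIndices q i m := by
  ext j
  constructor
  · rintro ⟨n, h1, h2⟩
    exact ⟨n - k, by rw [mul_sub]; linarith, by rw [mul_sub]; linarith⟩
  · rintro ⟨n, h1, h2⟩
    exact ⟨n + k, by rw [mul_add]; linarith, by rw [mul_add]; linarith⟩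

theorem le_of_arcIndices_subset {i : ℤ} {m m' : ℕ} (hm' : m' < q)
    (h : arcIndices q i m' ⊆ arcIndices q i m) : m' ≤ m := by
  by_contra! hlt
  -- The first index past the shorter arc; `m' < q` keeps it from wrapping round to the start.
  obtain ⟨n, h1, h2⟩ := h (show i + m + 1 ∈ arcIndices q i m' from ⟨0, by omega, by omega⟩)
  rcases le_or_gt 0 n with hn | hn
  · have : 0 ≤ (q : ℤ) * n := by positivity
    omega
  · have : (q : ℤ) * n ≤ q * (-1) := by gcongr; omega
    omega

theorem cellIndices_injective (hlt : 2 * p < q) : Function.Injective (cellIndices p q) := by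
  have hself : ∀ (i : ℤ) (m : ℕ), i ∈ arcIndices q i m := fun i m => ⟨0, by simp, by simp⟩
  rintro (_ | ⟨i, m⟩) (_ | ⟨i', m'⟩) h
  · rfl
  · exact absurd (h.ge (hself (i' : ℕ) m') : ((i' : ℕ) : ℤ) ∈ (∅ : Set ℤ)) (Set.notMem_empty _)
  · exact absurd (h.le (hself (i : ℕ) m) : ((i : ℕ) : ℤ) ∈ (∅ : Set ℤ)) (Set.notMem_empty _)
  · change arcIndices q (i : ℕ) m = arcIndices q (i' : ℕ) m' at h
    obtain ⟨n, h1, h2⟩ := (h ▸ hself (i : ℕ) m : ((i : ℕ) : ℤ) ∈ arcIndices q (i' : ℕ) m')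
    obtain ⟨n', h3, h4⟩ := (h ▸ hself (i' : ℕ) m' : ((i' : ℕ) : ℤ) ∈ arcIndices q (i : ℕ) m)
    have hi := i.2
    have hi' := i'.2
    have hm := m.2
    have hm' := m'.2
    have hq : (0 : ℤ) < q := by omega
    -- Each arc contains the start of the other; adding the inequalities gives `0 ≤ q(n + n') ≤ m +
    -- m' < q`.
    have hnn : n + n' = 0 := by
      have h5 : 0 ≤ (q : ℤ) * (n + n') := by rw [mul_add]; omega
      have h6 : (q : ℤ) * (n + n') < q * 1 := by rw [mul_add]; omega
      have h7 := nonneg_of_mul_nonneg_right h5 hq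
      have h8 := lt_of_mul_lt_mul_left h6 hq.le
      omega
    have hn' : n' = -n := by omega
    subst hn'
    rw [mul_neg] at h3 h4
    have hn0 : n = 0 := by
      have h5 : (q : ℤ) * n < q * 1 := by omega
      have h6 : (q : ℤ) * (-1) < q * n := by omega
      have h7 := lt_of_mul_lt_mul_left h5 hq.le
      have h8 := lt_of_mul_lt_mul_left h6 hq.le
      omega
    subst hn0
    have hii : i = i' := Fin.ext (by omega)
    subst hii
    have hmm : m = m' := Fin.ext (le_antisymm
      (le_of_arcIndices_subset (by omega) h.le)
      (le_of_arcIndices_subset (by omega) h.ge))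
    rw [hmm]

theorem height_isLinearMap (j : ℤ) : IsLinearMap ℝ (height q c j) :=
  ⟨fun x y => by simp [height, add_div], fun r x => by simp [height, mul_div_assoc]⟩

theorem continuous_height (j : ℤ) : Continuous (height q c j) :=
  Complex.continuous_re.comp (continuous_id.div_const _)

theorem convex_cell (U : Set ℤ) : Convex ℝ (cell p q c U) := by
  refine (convex_ball _ _).inter ?_
  simp only [Set.ofPred_forall, Set.ofPred_and]
  exact convex_iInter fun j =>
    (convex_iInter fun _ => convex_halfSpace_gt (height_isLinearMap j) _).inter
    (convex_iInter fun _ => convex_halfSpace_lt (height_isLinearMap j) _)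

theorem mem_arrangement_iff (hc : c ≠ 0) (hlt : 2 * p < q) {z : ℂ} :
    z ∈ Metric.ball 0 ‖c‖ \ ⋃ j : ℤ, chord p q c j ↔
      z ∈ Metric.ball 0 ‖c‖ ∧ ∀ j, height q c j z ≠ Real.cos (Real.pi * p / q) := by
  simp only [Set.mem_sdiff, Set.mem_iUnion, not_exists, mem_chord_iff hc hlt, mem_ball_zero_iff,
    not_and]
  exact ⟨fun h => ⟨h.1, fun j => h.2 j h.1.le⟩, fun h => ⟨h.1, fun j _ => h.2 j⟩⟩

/-- The dictionary from geometry to integers: `height` compares `cos(π(a - 2j)/q)` with `cos(πs/q)`,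
hence `|a - 2j|` modulo `2q` with `s`. -/
theorem lt_height_polarPoint_iff (hc : c ≠ 0) (hlt : 2 * p < q) (j : ℤ) (a : ℝ) {s : ℝ}
    (h0 : 0 ≤ s) (h1 : s ≤ p) :
    (Real.cos (Real.pi * p / q) < height q c j (polarPoint p q c a s) ↔
      ∃ n : ℤ, |a - 2 * (j + q * n)| < s) ∧
    (Real.cos (Real.pi * p / q) ≤ height q c j (polarPoint p q c a s) ↔
      ∃ n : ℤ, |a - 2 * (j + q * n)| ≤ s) := by
  have hκ := cos_half_pos hlt
  have hs := cos_angle_pos hlt (abs_le.2 ⟨by linarith, h1⟩ : |s| ≤ p)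
  have hpq : (p : ℝ) ≤ q := by exact_mod_cast (by omega : p ≤ q)
  have h := cos_angle_cases (by omega) h0 (h1.trans hpq) (a - 2 * j)
  have e : ∀ n : ℤ, a - 2 * j - 2 * q * n = a - 2 * (j + q * n) := fun n => by ring
  simp only [e] at h
  rw [height_polarPoint hc, lt_div_iff₀ hs, le_div_iff₀ hs, mul_lt_mul_iff_right₀ hκ,
    mul_le_mul_iff_right₀ hκ]
  exact h

theorem cell_nonempty (hc : c ≠ 0) (hlt : 2 * p < q) (u : Option (Fin q × Fin p)) :
    (cell p q c (cellIndices p q u)).Nonempty := by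
  rcases u with _ | ⟨i, m⟩
  · refine ⟨0, by simpa using hc, fun j => ⟨fun h => absurd h (Set.notMem_empty _), fun _ => ?_⟩⟩
    simpa [height] using cos_half_pos hlt
  · have hm : (m : ℝ) + 1 ≤ p := by exact_mod_cast m.2
    have hm0 : (0 : ℝ) ≤ (m : ℕ) := Nat.cast_nonneg _
    have hs : |(m : ℝ) + 1 / 2| ≤ p := by
      rw [abs_of_nonneg (by linarith)]
      linarith
    -- Direction midway between the normals `2i` and `2(i + m)`: `|a - 2J|` is at most `m` for `J`
    -- in the run and at least `m + 2` outside it, so `s = m + 1/2` separates them.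
    refine ⟨polarPoint p q c (2 * i + m) (m + 1 / 2), ?_, fun j => ?_⟩
    · rw [mem_ball_zero_iff, norm_polarPoint hlt hs]
      refine mul_lt_of_lt_one_right (norm_pos_iff.2 hc)
        ((div_lt_one (cos_angle_pos hlt hs)).2 ?_)
      rw [cos_angle_lt_iff hlt (by simp) hs, Nat.abs_cast, abs_of_nonneg (by linarith)]
      linarith
    · have h := lt_height_polarPoint_iff hc hlt j (2 * i + m) (s := m + 1 / 2) (by linarith)
        (by linarith)
      constructor
      · rintro ⟨n, h1, h2⟩
        refine h.1.2 ⟨n, ?_⟩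
        have h1' : ((i : ℕ) : ℝ) ≤ j + q * n := by exact_mod_cast h1
        have h2' : (j : ℝ) + q * n ≤ (i : ℕ) + (m : ℕ) := by exact_mod_cast h2
        rw [abs_lt]
        constructor <;> linarith
      · intro hj
        by_contra! hle
        obtain ⟨n, hn⟩ := h.2.1 hle
        refine hj ⟨n, ?_⟩
        rw [abs_le] at hn
        have h1 : ((i : ℕ) : ℝ) < (j + q * n : ℤ) + 1 := by push_cast; linarith
        have h2 : ((j + q * n : ℤ) : ℝ) < ((i : ℕ) + (m : ℕ) : ℤ) + 1 := by push_cast; linarith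
        have h1' : ((i : ℕ) : ℤ) < (j + q * n) + 1 := by exact_mod_cast h1
        have h2' : j + q * n < ((i : ℕ) + (m : ℕ) : ℤ) + 1 := by exact_mod_cast h2
        exact ⟨by omega, by omega⟩

theorem exists_cell (hc : c ≠ 0) (hlt : 2 * p < q) {z : ℂ} (hz : ‖z‖ < ‖c‖)
    (hne : ∀ j, height q c j z ≠ Real.cos (Real.pi * p / q)) :
    ∃ u, z ∈ cell p q c (cellIndices p q u) := by
  by_cases hall : ∀ j, height q c j z < Real.cos (Real.pi * p / q)
  · exact ⟨none, by simpa using hz, fun j => ⟨fun h => absurd h (Set.notMem_empty _),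
      fun _ => hall j⟩⟩
  push Not at hall
  obtain ⟨j₀, hj₀⟩ := hall
  have hcn : 0 < ‖c‖ := norm_pos_iff.2 hc
  -- A point on or beyond some chord is at least as far from the centre as the chord, so the
  -- coordinates `(a, s)` are available.
  obtain ⟨a, s, h0, h1, rfl⟩ := exists_polarPoint hc hlt (z := z) (by
    rw [← le_div_iff₀' hcn]
    exact hj₀.trans ((le_abs_self _).trans (abs_height_le _ _))) hz.le
  have hs : |s| ≤ p := abs_le.2 ⟨by linarith, h1⟩
  have hsp : s < p := by
    rw [norm_polarPoint hlt hs, mul_lt_iff_lt_one_right hcn,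
      div_lt_one (cos_angle_pos hlt hs), cos_angle_lt_iff hlt (by simp) hs, Nat.abs_cast,
      abs_of_nonneg h0] at hz
    exact hz
  have key := fun j => (lt_height_polarPoint_iff hc hlt j a h0 h1).1
  -- `i` and `t` are the extreme integers of the open interval `((a - s)/2, (a + s)/2)`, whose
  -- length `s < p` bounds the run.
  set i : ℤ := ⌊(a - s) / 2⌋ + 1 with hi
  set t : ℤ := ⌈(a + s) / 2⌉ - 1 with ht
  have hJ : ∀ J : ℤ, |a - 2 * J| < s ↔ i ≤ J ∧ J ≤ t := fun J => by
    rw [hi, ht, Int.add_one_le_iff, Int.floor_lt, Int.le_sub_one_iff, Int.lt_ceil, abs_lt]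
    constructor
    · rintro ⟨h2, h3⟩
      exact ⟨by linarith, by linarith⟩
    · rintro ⟨h2, h3⟩
      exact ⟨by linarith, by linarith⟩
  have hcast : ∀ j n : ℤ, (j : ℝ) + q * n = ((j + q * n : ℤ) : ℝ) := fun j n => by push_cast; rfl
  simp only [hcast, hJ] at key
  obtain ⟨n₀, h2, h3⟩ := (key j₀).1 (lt_of_le_of_ne hj₀ (hne j₀).symm)
  have hti : t - i < p := by
    have h4 := ((hJ i).2 ⟨le_rfl, by omega⟩)
    have h5 := ((hJ t).2 ⟨by omega, le_rfl⟩)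
    rw [abs_lt] at h4 h5
    have : ((t - i : ℤ) : ℝ) < (p : ℤ) := by push_cast; linarith
    exact_mod_cast this
  have hq : (0 : ℤ) < q := by omega
  have hi0 := Int.emod_nonneg i hq.ne'
  have hiq := Int.emod_lt_of_pos i hq
  refine ⟨some (⟨(i % q).toNat, by omega⟩, ⟨(t - i).toNat, by omega⟩), by simpa using hz, ?_⟩
  have harc : cellIndices p q (some (⟨(i % q).toNat, by omega⟩, ⟨(t - i).toNat, by omega⟩)) =
      {j | ∃ n : ℤ, i ≤ j + q * n ∧ j + q * n ≤ t} := by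
    change arcIndices q ((i % q).toNat : ℕ) (t - i).toNat = _
    rw [← arcIndices_add _ (i / q), Int.toNat_of_nonneg hi0, Int.emod_add_mul_ediv]
    unfold arcIndices
    rw [Int.toNat_of_nonneg (by omega)]
    simp
  intro j
  rw [harc]
  refine ⟨fun h => (key j).2 h, fun h => lt_of_le_of_ne (not_lt.1 fun h' => h ((key j).1 h'))
    (hne j)⟩

theorem card_regions (hc : c ≠ 0) (hlt : 2 * p < q) :
    Nat.card (ConnectedComponents ↥(Metric.ball (0 : ℂ) ‖c‖ \ ⋃ j : ℤ, chord p q c j)) =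
      p * q + 1 := by
  have hcard : Nat.card (Option (Fin q × Fin p)) = p * q + 1 := by
    simp [mul_comm]
  rw [← hcard]
  refine card_connectedComponents_of_partition (fun u => cell p q c (cellIndices p q u))
    -- The closed sets relax the strict inequalities; off the chords both versions agree.
    (fun u => {z | ∀ j : ℤ,
      (j ∈ cellIndices p q u → Real.cos (Real.pi * p / q) ≤ height q c j z) ∧
      (j ∉ cellIndices p q u → height q c j z ≤ Real.cos (Real.pi * p / q))})
    ?_ (cell_nonempty hc hlt) (fun u => (convex_cell _).isPreconnected) ?_ ?_ ?_ ?_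
  · ext z
    rw [mem_arrangement_iff hc hlt, Set.mem_iUnion]
    constructor
    · rintro ⟨h1, h2⟩
      exact exists_cell hc hlt (by simpa using h1) h2
    · rintro ⟨u, h1, h2⟩
      refine ⟨h1, fun j => ?_⟩
      by_cases hj : j ∈ cellIndices p q u
      · exact ((h2 j).1 hj).ne'
      · exact ((h2 j).2 hj).ne
  · intro u
    simp only [Set.ofPred_forall, Set.ofPred_and]
    exact isClosed_iInter fun j => (isClosed_iInter fun _ =>
      isClosed_le continuous_const (continuous_height j)).inter
      (isClosed_iInter fun _ => isClosed_le (continuous_height j) continuous_const)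
  · exact fun u z hz j => ⟨fun h => ((hz.2 j).1 h).le, fun h => ((hz.2 j).2 h).le⟩
  · rintro u z ⟨h1, h2⟩
    rw [mem_arrangement_iff hc hlt] at h2
    exact ⟨h2.1, fun j => ⟨fun h => lt_of_le_of_ne ((h1 j).1 h) (h2.2 j).symm,
      fun h => lt_of_le_of_ne ((h1 j).2 h) (h2.2 j)⟩⟩
  · intro u u' hne
    refine Set.disjoint_left.2 fun z hz hz' => hne (cellIndices_injective hlt ?_)
    ext j
    constructor
    · intro h
      by_contra h'
      exact lt_asymm ((hz.2 j).1 h) ((hz'.2 j).2 h')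
    · intro h
      by_contra h'
      exact lt_asymm ((hz'.2 j).1 h) ((hz.2 j).2 h')

/-! ### Vertices -/

/-- The points in which two different chords meet. -/
def crossings (p q : ℕ) (c : ℂ) : Set ℂ :=
  {z | ∃ j d : ℤ, 1 ≤ d ∧ d ≤ p ∧ z = polarPoint p q c (2 * j + d) d}

/-- At parameter `m` chord `j` meets chord `j + m`. For `m < 0` the crossing is listed under `j +
m`, with `d = -m`. -/
theorem chordPoint_mem_crossings_iff (hc : c ≠ 0) (hlt : 2 * p < q) (j : ℤ) {s : ℝ}
    (hs : |s| ≤ p) :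
    polarPoint p q c (2 * j + s) s ∈ crossings p q c ↔ ∃ m : ℤ, m ≠ 0 ∧ s = m := by
  constructor
  · rintro ⟨i, d, h1, h2, h⟩
    have hd : |(d : ℝ)| ≤ p := by
      rw [abs_of_nonneg (by exact_mod_cast (by omega : 0 ≤ d))]
      exact_mod_cast h2
    rcases abs_eq_abs.1 ((polarPoint_eq_iff hc hlt hs hd).1 h).1 with h | h
    · exact ⟨d, by omega, h⟩
    · exact ⟨-d, by omega, by rw [h]; push_cast; rfl⟩
  · rintro ⟨m, hm, rfl⟩
    have hm' : |m| ≤ p := by exact_mod_cast hs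
    rw [abs_le] at hm'
    rcases lt_or_gt_of_ne hm with h | h
    · refine ⟨j + m, -m, by omega, by omega, ?_⟩
      push_cast
      rw [polarPoint_neg]
      congr 1
      ring
    · exact ⟨j, m, by omega, by omega, rfl⟩

theorem ray_mem_crossings_iff (hp : 1 ≤ p) (hc : c ≠ 0) (hlt : 2 * p < q) (a : ℝ) :
    ray q c a ∈ crossings p q c ↔ ∃ j : ℤ, a = 2 * j + p := by
  rw [← polarPoint_boundary hlt]
  constructor
  · rintro ⟨i, d, h1, h2, h⟩
    have hd0 : (0 : ℝ) ≤ d := by exact_mod_cast (by omega : 0 ≤ d)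
    have hd : |(d : ℝ)| ≤ p := by
      rw [abs_of_nonneg hd0]
      exact_mod_cast h2
    obtain ⟨h3, n, h4⟩ := (polarPoint_eq_iff hc hlt (by simp) hd).1 h
    rw [Nat.abs_cast, abs_of_nonneg hd0] at h3
    refine ⟨i + q * n, ?_⟩
    rw [h4, h3]
    push_cast
    ring
  · rintro ⟨j, rfl⟩
    exact ⟨j, p, by omega, le_rfl, by push_cast; rfl⟩

/-- Equal points have `|s| = |t|`. If `s = t`, the directions agree only for equal indices modulo
`q`; if `s = -t`, they give `s = j - i + qn`, an integer. -/
theorem chordPoint_eq (hc : c ≠ 0) (hlt : 2 * p < q) {i j : ℤ} {s t : ℝ} (hs : |s| ≤ p)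
    (ht : |t| ≤ p) (h : polarPoint p q c (2 * i + s) s = polarPoint p q c (2 * j + t) t) :
    (s = t ∧ ∃ n : ℤ, i = j + q * n) ∨ ∃ m : ℤ, m ≠ 0 ∧ s = m := by
  obtain ⟨h1, n, h2⟩ := (polarPoint_eq_iff hc hlt hs ht).1 h
  have key : s = t → ∃ n : ℤ, i = j + q * n := fun hst => by
    refine ⟨n, ?_⟩
    have : (i : ℝ) = (j + q * n : ℤ) := by
      push_cast
      linarith
    exact_mod_cast this
  rcases abs_eq_abs.1 h1 with h | h
  · exact Or.inl ⟨h, key h⟩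
  · by_cases h0 : s = 0
    · have hst : s = t := by linarith
      exact Or.inl ⟨hst, key hst⟩
    · have hm : s = (j - i + q * n : ℤ) := by
        push_cast
        linarith
      exact Or.inr ⟨_, fun h' => h0 (by rw [hm, h', Int.cast_zero]), hm⟩

theorem chord_add (hc : c ≠ 0) (hq : 0 < q) (j n : ℤ) :
    chord p q c (j + q * n) = chord p q c j := by
  unfold chord
  refine Set.image_congr fun s _ => ?_
  rw [← polarPoint_add_two_mul hc hq (2 * j + s) s n]
  congr 1
  push_cast
  ring

theorem chord_eq_iff (hc : c ≠ 0) (hlt : 2 * p < q) {i j : ℤ} :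
    chord p q c i = chord p q c j ↔ ∃ n : ℤ, i = j + q * n := by
  constructor
  · intro h
    have h0 : |(0 : ℝ)| ≤ p := by simp
    -- The foot of the normal, `s = 0`, is not a crossing, so it identifies the chord.
    have h1 : polarPoint p q c (2 * i + (0 : ℝ)) 0 ∈ chord p q c i := ⟨0, abs_le.1 h0, rfl⟩
    rw [h] at h1
    obtain ⟨t, ht, h1⟩ := h1
    rcases chordPoint_eq hc hlt h0 (abs_le.2 ht) h1.symm with h2 | ⟨m, hm, h2⟩
    · exact h2.2
    · exact absurd (by exact_mod_cast h2.symm) hm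
  · rintro ⟨n, rfl⟩
    exact chord_add hc (by omega) _ _

theorem fin_eq_of_eq_add_mul {i j : Fin q} {n : ℤ} (h : ((i : ℕ) : ℤ) = (j : ℕ) + q * n) :
    i = j := by
  have h4 : ((i : ℕ) : ℤ) % q = ((j : ℕ) : ℤ) % q := by rw [h, Int.add_mul_emod_self_left]
  rw [Int.emod_eq_of_lt (by omega) (by omega), Int.emod_eq_of_lt (by omega) (by omega)] at h4
  exact Fin.ext (by exact_mod_cast h4)

theorem ncard_crossings (hc : c ≠ 0) (hlt : 2 * p < q) : (crossings p q c).ncard = p * q := by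
  have hq : (0 : ℤ) < q := by omega
  set f : Fin q × Fin p → ℂ := fun x =>
    polarPoint p q c (2 * (x.1 : ℕ) + ((x.2 : ℕ) + 1 : ℝ)) ((x.2 : ℕ) + 1) with hf
  have hb : ∀ m : Fin p, |((m : ℕ) + 1 : ℝ)| ≤ p := fun m => by
    rw [abs_of_nonneg (by positivity)]
    exact_mod_cast m.2
  have hinj : Function.Injective f := by
    rintro ⟨i, m⟩ ⟨j, l⟩ h
    obtain ⟨h1, n, h2⟩ := (polarPoint_eq_iff hc hlt (hb m) (hb l)).1 h
    rw [abs_of_nonneg (by positivity), abs_of_nonneg (by positivity)] at h1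
    have hml : (m : ℕ) = l := by exact_mod_cast (add_right_cancel h1)
    have h3 : ((i : ℕ) : ℤ) = (j : ℕ) + q * n := by
      have : ((i : ℕ) : ℝ) = ((j : ℕ) + q * n : ℤ) := by
        push_cast
        rw [hml] at h2
        linarith
      exact_mod_cast this
    exact Prod.ext (fin_eq_of_eq_add_mul h3) (Fin.ext hml)
  have hrange : crossings p q c = f '' Set.univ := by
    rw [Set.image_univ]
    ext z
    constructor
    · rintro ⟨j, d, h1, h2, rfl⟩
      have hj0 := Int.emod_nonneg j hq.ne'
      have hjq := Int.emod_lt_of_pos j hq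
      refine ⟨(⟨(j % q).toNat, by omega⟩, ⟨(d - 1).toNat, by omega⟩), ?_⟩
      have e1 : (((j % q).toNat : ℕ) : ℝ) = ((j % q : ℤ) : ℝ) := by
        exact_mod_cast congrArg (Int.cast (R := ℝ)) (Int.toNat_of_nonneg hj0)
      have e2 : (((d - 1).toNat : ℕ) : ℝ) + 1 = d := by
        have := congrArg (Int.cast (R := ℝ)) (Int.toNat_of_nonneg (by omega : 0 ≤ d - 1))
        push_cast at this
        linarith
      have e3 : (j : ℝ) = ((j % q : ℤ) : ℝ) + q * (j / q : ℤ) := by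
        exact_mod_cast (Int.emod_add_mul_ediv j q).symm
      simp only [hf, e1, e2]
      rw [← polarPoint_add_two_mul hc (by omega) _ _ (j / q)]
      congr 1
      rw [e3]
      ring
    · rintro ⟨⟨i, m⟩, rfl⟩
      refine ⟨(i : ℕ), (m : ℕ) + 1, by omega, by omega, ?_⟩
      simp [hf]
  rw [hrange, Set.ncard_image_of_injective _ hinj, Set.ncard_univ]
  simp [mul_comm]

/-! ### Edges -/

/-- The nonzero integers between `-p` and `p` in increasing order: the positions of the crossings
on a chord. -/
def node (p g : ℕ) : ℤ := if g < p then g - p else g - p + 1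

theorem node_lt (g : ℕ) : node p g < node p (g + 1) := by
  unfold node
  split_ifs <;> omega

/-- The index set of the edges: `2 p - 1` on each of the `q` chords, and `q` on the circle. -/
abbrev EdgeIndex (p q : ℕ) : Type := (Fin q × Fin (2 * p - 1)) ⊕ Fin q

/-- The edges of the drawing without their end points. -/
def openEdge (p q : ℕ) (c : ℂ) : EdgeIndex p q → Set ℂ
  | Sum.inl (j, g) => (fun s : ℝ => polarPoint p q c (2 * ((j : ℕ) : ℤ) + s) s) ''
      Set.Ioo (node p g : ℝ) (node p (g + 1))
  | Sum.inr j => ray q c '' Set.Ioo (2 * (j : ℕ) + p : ℝ) (2 * (j : ℕ) + p + 2)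

/-- The edges of the drawing with their end points. -/
def closedEdge (p q : ℕ) (c : ℂ) : EdgeIndex p q → Set ℂ
  | Sum.inl (j, g) => (fun s : ℝ => polarPoint p q c (2 * ((j : ℕ) : ℤ) + s) s) ''
      Set.Icc (node p g : ℝ) (node p (g + 1))
  | Sum.inr j => ray q c '' Set.Icc (2 * (j : ℕ) + p : ℝ) (2 * (j : ℕ) + p + 2)

theorem abs_le_of_mem_Icc_node {g : ℕ} (hg : g < 2 * p - 1) {s : ℝ}
    (hs : s ∈ Set.Icc (node p g : ℝ) (node p (g + 1))) : |s| ≤ p := by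
  have h1 : -(p : ℤ) ≤ node p g := by unfold node; split_ifs <;> omega
  have h2 : node p (g + 1) ≤ p := by unfold node; split_ifs <;> omega
  have h1' : -(p : ℝ) ≤ node p g := by exact_mod_cast h1
  have h2' : (node p (g + 1) : ℝ) ≤ p := by exact_mod_cast h2
  exact abs_le.2 ⟨h1'.trans hs.1, hs.2.trans h2'⟩

theorem continuous_ray : Continuous (ray q c) := by
  unfold ray
  fun_prop

theorem continuousOn_chordPoint (hlt : 2 * p < q) (b : ℝ) {t : Set ℝ} (ht : ∀ s ∈ t, |s| ≤ p) :
    ContinuousOn (fun s : ℝ => polarPoint p q c (b + s) s) t := by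
  unfold polarPoint
  refine (continuous_ray.comp (by fun_prop)).continuousOn.mul ?_
  refine Complex.continuous_ofReal.comp_continuousOn
    (continuousOn_const.div (Continuous.continuousOn (by fun_prop)) fun s hs => ?_)
  exact (cos_angle_pos hlt (ht s hs)).ne'

theorem isPreconnected_openEdge (hlt : 2 * p < q) (e : EdgeIndex p q) :
    IsPreconnected (openEdge p q c e) := by
  rcases e with ⟨j, g⟩ | j
  · exact isPreconnected_Ioo.image _ (continuousOn_chordPoint hlt _ fun s hs =>
      abs_le_of_mem_Icc_node g.2 (Set.Ioo_subset_Icc_self hs))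
  · exact isPreconnected_Ioo.image _ continuous_ray.continuousOn

theorem openEdge_nonempty (e : EdgeIndex p q) : (openEdge p q c e).Nonempty := by
  rcases e with ⟨j, g⟩ | j
  · exact (Set.nonempty_Ioo.2 (by exact_mod_cast node_lt g)).image _
  · exact (Set.nonempty_Ioo.2 (by linarith)).image _

theorem isClosed_closedEdge (hlt : 2 * p < q) (e : EdgeIndex p q) :
    IsClosed (closedEdge p q c e) := by
  rcases e with ⟨j, g⟩ | j
  · exact (isCompact_Icc.image_of_continuousOn (continuousOn_chordPoint hlt _ fun s hs =>
      abs_le_of_mem_Icc_node g.2 hs)).isClosed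
  · exact (isCompact_Icc.image continuous_ray).isClosed

theorem openEdge_subset_closedEdge (e : EdgeIndex p q) :
    openEdge p q c e ⊆ closedEdge p q c e := by
  rcases e with ⟨j, g⟩ | j <;> exact Set.image_mono Set.Ioo_subset_Icc_self

theorem node_ne_zero (g : ℕ) : node p g ≠ 0 := by
  unfold node
  split_ifs <;> omega

theorem closedEdge_diff_crossings (hp : 1 ≤ p) (hc : c ≠ 0) (hlt : 2 * p < q)
    (e : EdgeIndex p q) : closedEdge p q c e \ crossings p q c ⊆ openEdge p q c e := by
  rcases e with ⟨j, g⟩ | j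
  · rintro _ ⟨⟨s, hs, rfl⟩, h⟩
    simp only at h
    rw [chordPoint_mem_crossings_iff hc hlt _ (abs_le_of_mem_Icc_node g.2 hs)] at h
    push Not at h
    exact ⟨s, ⟨lt_of_le_of_ne hs.1 (h _ (node_ne_zero _)).symm,
      lt_of_le_of_ne hs.2 (h _ (node_ne_zero _))⟩, rfl⟩
  · rintro _ ⟨⟨a, ha, rfl⟩, h⟩
    rw [ray_mem_crossings_iff hp hc hlt] at h
    push Not at h
    refine ⟨a, ⟨lt_of_le_of_ne ha.1 fun h' => h (j : ℕ) ?_,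
      lt_of_le_of_ne ha.2 fun h' => h ((j : ℕ) + 1) ?_⟩, rfl⟩
    · rw [← h']
      push_cast
      rfl
    · rw [h']
      push_cast
      ring

theorem openEdge_disjoint_crossings (hp : 1 ≤ p) (hc : c ≠ 0) (hlt : 2 * p < q)
    (e : EdgeIndex p q) {z : ℂ} (hz : z ∈ openEdge p q c e) : z ∉ crossings p q c := by
  rcases e with ⟨j, g⟩ | j
  · obtain ⟨s, hs, rfl⟩ := hz
    simp only
    rw [chordPoint_mem_crossings_iff hc hlt _
      (abs_le_of_mem_Icc_node g.2 (Set.Ioo_subset_Icc_self hs))]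
    rintro ⟨m, hm, rfl⟩
    have h1 : node p g < m := by exact_mod_cast hs.1
    have h2 : m < node p (g + 1) := by exact_mod_cast hs.2
    unfold node at h1 h2
    split_ifs at h1 h2 <;> omega
  · obtain ⟨a, ha, rfl⟩ := hz
    rw [ray_mem_crossings_iff hp hc hlt]
    rintro ⟨m, rfl⟩
    have h1 : ((j : ℕ) : ℝ) < m := by linarith [ha.1]
    have h2 : (m : ℝ) < (j : ℕ) + 1 := by linarith [ha.2]
    have h1' : ((j : ℕ) : ℤ) < m := by exact_mod_cast h1
    have h2' : m < (j : ℕ) + 1 := by exact_mod_cast h2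
    omega

theorem exists_openEdge_chord (hp : 1 ≤ p) (hc : c ≠ 0) (hlt : 2 * p < q) (j : ℤ) {s : ℝ}
    (hs : |s| ≤ p) (h : ∀ m : ℤ, m ≠ 0 → s ≠ m) :
    ∃ e, polarPoint p q c (2 * j + s) s ∈ openEdge p q c e := by
  have hq : (0 : ℤ) < q := by omega
  have hj0 := Int.emod_nonneg j hq.ne'
  have hjq := Int.emod_lt_of_pos j hq
  suffices hg : ∃ g : ℕ, g < 2 * p - 1 ∧ (node p g : ℝ) < s ∧ s < node p (g + 1) by
    obtain ⟨g, hg, h1, h2⟩ := hg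
    refine ⟨Sum.inl (⟨(j % q).toNat, by omega⟩, ⟨g, hg⟩), s, ⟨h1, h2⟩, ?_⟩
    simp only
    rw [Int.toNat_of_nonneg hj0, ← polarPoint_add_two_mul hc (by omega) _ _ (j / q)]
    congr 1
    have e3 : (j : ℝ) = ((j % q : ℤ) : ℝ) + q * (j / q : ℤ) := by
      exact_mod_cast (Int.emod_add_mul_ediv j q).symm
    rw [e3]
    ring
  have hf1 := Int.floor_le s
  have hf2 := Int.lt_floor_add_one s
  set f := ⌊s⌋ with hf
  rw [abs_le] at hs
  have hfp : -(p : ℤ) ≤ f := Int.le_floor.2 (by push_cast; exact hs.1)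
  have hfp' : f ≤ p := by exact_mod_cast hf1.trans hs.2
  have hfp'' : f < p := by
    refine lt_of_le_of_ne hfp' fun h' => ?_
    refine h p (by omega) (le_antisymm hs.2 ?_)
    have : (f : ℝ) = p := by exact_mod_cast h'
    push_cast
    linarith
  -- No crossing sits at `0`, so the unit intervals on both sides of it form one edge, from `-1` to
  -- `1`, with index `p - 1`.
  by_cases hmid : f = 0 ∨ f = -1
  · refine ⟨p - 1, by omega, ?_, ?_⟩
    · have : node p (p - 1) = -1 := by unfold node; split_ifs <;> omega
      rw [this]
      rcases hmid with h0 | h0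
      · rw [h0] at hf1
        push_cast at hf1 ⊢
        linarith
      · refine lt_of_le_of_ne (by rw [h0] at hf1; exact hf1) (h (-1) (by omega)).symm
    · have : node p (p - 1 + 1) = 1 := by unfold node; split_ifs <;> omega
      rw [this]
      rcases hmid with h0 | h0
      · rw [h0] at hf2
        push_cast at hf2 ⊢
        linarith
      · rw [h0] at hf2
        push_cast at hf2 ⊢
        linarith
  · push Not at hmid
    have hlow : (f : ℝ) < s := lt_of_le_of_ne hf1 (h f hmid.1).symm
    by_cases hneg : f < 0
    · refine ⟨(f + p).toNat, by omega, ?_, ?_⟩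
      · have : node p (f + p).toNat = f := by unfold node; split_ifs <;> omega
        rw [this]
        exact hlow
      · have : node p ((f + p).toNat + 1) = f + 1 := by unfold node; split_ifs <;> omega
        rw [this]
        exact_mod_cast hf2
    -- Beyond the skipped `0` the index drops by one.
    · refine ⟨(f + p - 1).toNat, by omega, ?_, ?_⟩
      · have : node p (f + p - 1).toNat = f := by unfold node; split_ifs <;> omega
        rw [this]
        exact hlow
      · have : node p ((f + p - 1).toNat + 1) = f + 1 := by unfold node; split_ifs <;> omega
        rw [this]
        exact_mod_cast hf2

theorem exists_ray_of_norm_eq (hc : c ≠ 0) (hlt : 2 * p < q) {z : ℂ} (hz : ‖z‖ = ‖c‖) :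
    ∃ a, z = ray q c a := by
  refine ⟨q / Real.pi * Complex.arg (z / c), ?_⟩
  have hq : (q : ℝ) ≠ 0 := by exact_mod_cast (by omega : q ≠ 0)
  have h5 : Real.pi * (q / Real.pi * Complex.arg (z / c)) / q = Complex.arg (z / c) := by
    field_simp [Real.pi_ne_zero]
  have h := Complex.norm_mul_exp_arg_mul_I (z / c)
  rw [norm_div, hz, div_self (norm_ne_zero_iff.2 hc), Complex.ofReal_one, one_mul] at h
  rw [ray, h5, h, mul_div_cancel₀ _ hc]

theorem exists_openEdge_circle (hc : c ≠ 0) (hlt : 2 * p < q) {a : ℝ}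
    (h : ∀ j : ℤ, a ≠ 2 * j + p) : ∃ e, ray q c a ∈ openEdge p q c e := by
  have hq : (0 : ℤ) < q := by omega
  set f := ⌊(a - p) / 2⌋ with hf
  have hf1 := Int.floor_le ((a - p) / 2)
  have hf2 := Int.lt_floor_add_one ((a - p) / 2)
  rw [← hf] at hf1 hf2
  have hj0 := Int.emod_nonneg f hq.ne'
  have hjq := Int.emod_lt_of_pos f hq
  have e1 : (((f % q).toNat : ℕ) : ℝ) = ((f % q : ℤ) : ℝ) := by
    exact_mod_cast congrArg (Int.cast (R := ℝ)) (Int.toNat_of_nonneg hj0)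
  have e3 : (f : ℝ) = ((f % q : ℤ) : ℝ) + q * (f / q : ℤ) := by
    exact_mod_cast (Int.emod_add_mul_ediv f q).symm
  have hlow : 2 * (f : ℝ) + p < a := lt_of_le_of_ne (by linarith) (h f).symm
  refine ⟨Sum.inr ⟨(f % q).toNat, by omega⟩, a - 2 * q * (f / q : ℤ), ?_, ?_⟩
  · simp only [e1]
    constructor <;> linarith
  · rw [ray_eq_ray_iff hc (by omega)]
    exact ⟨-(f / q), by push_cast; ring⟩

theorem node_strictMono : StrictMono (node p) := strictMono_nat_of_lt_succ node_lt

theorem norm_lt_of_mem_openEdge_inl (hc : c ≠ 0) (hlt : 2 * p < q)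
    (x : Fin q × Fin (2 * p - 1)) {z : ℂ} (hz : z ∈ openEdge p q c (Sum.inl x)) :
    ‖z‖ < ‖c‖ := by
  obtain ⟨s, hs, rfl⟩ := hz
  have h1 := abs_le_of_mem_Icc_node x.2.2 (Set.Ioo_subset_Icc_self hs)
  have h2 : |s| < p := by
    have a1 : -(p : ℤ) ≤ node p x.2 := by unfold node; split_ifs <;> omega
    have a2 : node p (x.2 + 1) ≤ p := by unfold node; split_ifs <;> omega
    have a1' : -(p : ℝ) ≤ node p x.2 := by exact_mod_cast a1
    have a2' : (node p (x.2 + 1) : ℝ) ≤ p := by exact_mod_cast a2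
    exact abs_lt.2 ⟨a1'.trans_lt hs.1, hs.2.trans_le a2'⟩
  simp only
  rw [norm_polarPoint hlt h1]
  refine mul_lt_of_lt_one_right (norm_pos_iff.2 hc) ((div_lt_one (cos_angle_pos hlt h1)).2 ?_)
  rwa [cos_angle_lt_iff hlt (by simp) h1, Nat.abs_cast]

/-- The norm separates arcs from chord pieces. Away from the crossings a point lies on a single
chord, and there the increasing nodes fix the piece. -/
theorem openEdge_index_unique (hp : 1 ≤ p) (hc : c ≠ 0) (hlt : 2 * p < q) {e e' : EdgeIndex p q}
    {z : ℂ} (hz : z ∈ openEdge p q c e) (hz' : z ∈ openEdge p q c e') : e = e' := by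
  have hcirc : ∀ j, z ∈ openEdge p q c (Sum.inr j) → ‖z‖ = ‖c‖ := by
    rintro j ⟨a, -, rfl⟩
    exact norm_ray a
  have hnc := openEdge_disjoint_crossings hp hc hlt e hz
  rcases e with x | j <;> rcases e' with x' | j'
  · obtain ⟨j, g⟩ := x
    obtain ⟨j', g'⟩ := x'
    obtain ⟨s, hs, rfl⟩ := hz
    obtain ⟨t, ht, h⟩ := hz'
    have hs' := abs_le_of_mem_Icc_node g.2 (Set.Ioo_subset_Icc_self hs)
    have ht' := abs_le_of_mem_Icc_node g'.2 (Set.Ioo_subset_Icc_self ht)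
    simp only at hnc
    rw [chordPoint_mem_crossings_iff hc hlt _ hs'] at hnc
    rcases chordPoint_eq hc hlt hs' ht' h.symm with ⟨rfl, n, h2⟩ | h2
    · have h3 : ((g : ℕ) : ℤ) < (g' : ℕ) + 1 := by
        have : node p g < node p (g' + 1) := by exact_mod_cast hs.1.trans ht.2
        exact_mod_cast node_strictMono.lt_iff_lt.1 this
      have h4 : ((g' : ℕ) : ℤ) < (g : ℕ) + 1 := by
        have : node p g' < node p (g + 1) := by exact_mod_cast ht.1.trans hs.2
        exact_mod_cast node_strictMono.lt_iff_lt.1 this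
      rw [fin_eq_of_eq_add_mul h2, Fin.ext (by omega : (g : ℕ) = g')]
    · exact absurd h2 hnc
  · exact absurd (hcirc j' hz') (norm_lt_of_mem_openEdge_inl hc hlt x hz).ne
  · exact absurd (hcirc j hz) (norm_lt_of_mem_openEdge_inl hc hlt x' hz').ne
  · obtain ⟨a, ha, rfl⟩ := hz
    obtain ⟨b, hb, h⟩ := hz'
    obtain ⟨n, h1⟩ := (ray_eq_ray_iff hc (by omega)).1 h.symm
    have h2 : ((j : ℕ) : ℝ) < (j' : ℕ) + q * n + 1 := by linarith [ha.1, hb.2]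
    have h3 : ((j' : ℕ) : ℝ) + q * n < (j : ℕ) + 1 := by linarith [ha.2, hb.1]
    have h2' : ((j : ℕ) : ℤ) < (j' : ℕ) + q * n + 1 := by exact_mod_cast h2
    have h3' : ((j' : ℕ) : ℤ) + q * n < (j : ℕ) + 1 := by exact_mod_cast h3
    rw [fin_eq_of_eq_add_mul (by omega : ((j : ℕ) : ℤ) = (j' : ℕ) + q * n)]

theorem card_edges (hp : 1 ≤ p) (hc : c ≠ 0) (hlt : 2 * p < q) :
    Nat.card (ConnectedComponents
      ↥((Metric.sphere (0 : ℂ) ‖c‖ ∪ ⋃ j : ℤ, chord p q c j) \ crossings p q c)) =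
      2 * p * q := by
  have hcard : Nat.card (EdgeIndex p q) = 2 * p * q := by
    rw [Nat.card_sum, Nat.card_prod, Nat.card_fin, Nat.card_fin]
    obtain ⟨k, rfl⟩ := Nat.exists_eq_add_of_le' hp
    rw [show 2 * (k + 1) - 1 = 2 * k + 1 by omega]
    ring
  rw [← hcard]
  refine card_connectedComponents_of_partition (openEdge p q c) (closedEdge p q c) ?_
    openEdge_nonempty (isPreconnected_openEdge hlt) (isClosed_closedEdge hlt)
    openEdge_subset_closedEdge
    (fun e z hz => closedEdge_diff_crossings hp hc hlt e ⟨hz.1, hz.2.2⟩)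
    (fun e e' hne => Set.disjoint_left.2 fun z hz hz' =>
      hne (openEdge_index_unique hp hc hlt hz hz'))
  ext z
  rw [Set.mem_iUnion]
  constructor
  · rintro ⟨h | h, hnc⟩
    · obtain ⟨a, rfl⟩ := exists_ray_of_norm_eq hc hlt (z := z) (by simpa using h)
      rw [ray_mem_crossings_iff hp hc hlt] at hnc
      push Not at hnc
      exact exists_openEdge_circle hc hlt hnc
    · obtain ⟨j, s, hs, rfl⟩ := Set.mem_iUnion.1 h
      simp only at hnc
      rw [chordPoint_mem_crossings_iff hc hlt _ (abs_le.2 hs)] at hnc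
      push Not at hnc
      exact exists_openEdge_chord hp hc hlt j (abs_le.2 hs) hnc
  · rintro ⟨e, he⟩
    refine ⟨?_, openEdge_disjoint_crossings hp hc hlt e he⟩
    rcases e with ⟨j, g⟩ | j
    · obtain ⟨s, hs, rfl⟩ := he
      exact Or.inr (Set.mem_iUnion.2 ⟨(j : ℕ), s,
        abs_le.1 (abs_le_of_mem_Icc_node g.2 (Set.Ioo_subset_Icc_self hs)), rfl⟩)
    · obtain ⟨a, -, rfl⟩ := he
      exact Or.inl (by simp [norm_ray])

/-! ### From billiard paths to chords -/

/-- The base point `P₀ exp(iϑ/2)` points along the normal of the first path, which makes that path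
chord `0`. -/
theorem point_eq_ray {p q : ℕ} (hq : 0 < q) {R : ℝ} (hR : 0 < R) {P₀ : ℂ} (hP : ‖P₀‖ = R)
    {ϑ : ℝ} (hϑ : ϑ = (p : ℝ) / q * (2 * Real.pi)) (n : ℕ) :
    point R P₀ ϑ n =
      ray q (P₀ * Complex.exp ((ϑ / 2 : ℝ) * Complex.I)) (2 * (p * n : ℤ) - p) := by
  have hq' : (q : ℂ) ≠ 0 := by exact_mod_cast hq.ne'
  rw [point_eq hR hP, ray, mul_assoc, ← Complex.exp_add, hϑ]
  congr 2
  push_cast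
  field_simp
  ring

theorem path_eq_chord {p q : ℕ} (hp : 1 ≤ p) (hlt : 2 * p < q) {R : ℝ} (hR : 0 < R) {P₀ : ℂ}
    (hP : ‖P₀‖ = R) {ϑ : ℝ} (hϑ : ϑ = (p : ℝ) / q * (2 * Real.pi)) (k : ℕ) :
    path R P₀ ϑ k = chord p q (P₀ * Complex.exp ((ϑ / 2 : ℝ) * Complex.I)) (p * k) := by
  have hP0 : P₀ ≠ 0 := norm_pos_iff.1 (hP ▸ hR)
  rw [← segment_ray hp (mul_ne_zero hP0 (Complex.exp_ne_zero _)) hlt, path,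
    point_eq_ray (by omega) hR hP hϑ, point_eq_ray (by omega) hR hP hϑ]
  congr 2
  push_cast
  ring

/-- By Bézout `p` is invertible modulo `q`, so the first `q` paths reach every chord. -/
theorem exists_lt_eq_mul_add {p q : ℕ} (hpq : Nat.gcd p q = 1) (hq : 0 < q) (j : ℤ) :
    ∃ k < q, ∃ n : ℤ, j = (p * k : ℤ) + q * n := by
  have hb : (1 : ℤ) = p * p.gcdA q + q * p.gcdB q := by
    rw [← Nat.gcd_eq_gcd_ab, hpq]
    rfl
  have hq' : (0 : ℤ) < q := by omega
  set x := p.gcdA q * j with hx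
  have h0 := Int.emod_nonneg x hq'.ne'
  have h1 := Int.emod_lt_of_pos x hq'
  refine ⟨(x % q).toNat, by omega, p * (x / q) + p.gcdB q * j, ?_⟩
  rw [Int.toNat_of_nonneg h0]
  have h2 := Int.emod_add_mul_ediv x q
  linear_combination j * hb - p * h2 + p * hx

theorem trajectory_eq {p q : ℕ} (hp : 1 ≤ p) (hpq : Nat.gcd p q = 1) (hlt : 2 * p < q) {R : ℝ}
    (hR : 0 < R) {P₀ : ℂ} (hP : ‖P₀‖ = R) {ϑ : ℝ} (hϑ : ϑ = (p : ℝ) / q * (2 * Real.pi)) :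
    trajectory R P₀ ϑ q =
      ⋃ j : ℤ, chord p q (P₀ * Complex.exp ((ϑ / 2 : ℝ) * Complex.I)) j := by
  have hP0 : P₀ ≠ 0 := norm_pos_iff.1 (hP ▸ hR)
  have hc := mul_ne_zero hP0 (Complex.exp_ne_zero ((ϑ / 2 : ℝ) * Complex.I))
  ext z
  simp only [trajectory, Set.mem_iUnion, path_eq_chord hp hlt hR hP hϑ, exists_prop]
  constructor
  · rintro ⟨k, -, hk⟩
    exact ⟨_, hk⟩
  · rintro ⟨j, hj⟩
    obtain ⟨k, hk, n, rfl⟩ := exists_lt_eq_mul_add hpq (by omega) j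
    exact ⟨k, hk, by rwa [chord_add hc (by omega)] at hj⟩

theorem vertices_eq {p q : ℕ} (hp : 1 ≤ p) (hpq : Nat.gcd p q = 1) (hlt : 2 * p < q) {R : ℝ}
    (hR : 0 < R) {P₀ : ℂ} (hP : ‖P₀‖ = R) {ϑ : ℝ} (hϑ : ϑ = (p : ℝ) / q * (2 * Real.pi)) :
    vertices R P₀ ϑ q = crossings p q (P₀ * Complex.exp ((ϑ / 2 : ℝ) * Complex.I)) := by
  have hP0 : P₀ ≠ 0 := norm_pos_iff.1 (hP ▸ hR)
  have hc := mul_ne_zero hP0 (Complex.exp_ne_zero ((ϑ / 2 : ℝ) * Complex.I))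
  have hq : (0 : ℤ) < q := by omega
  simp only [vertices, path_eq_chord hp hlt hR hP hϑ, point_eq_ray (by omega) hR hP hϑ]
  generalize P₀ * Complex.exp ((ϑ / 2 : ℝ) * Complex.I) = c at hc ⊢
  ext z
  constructor
  · rintro (⟨k, -, rfl⟩ | ⟨j, -, k, -, hne, ⟨s, hs, rfl⟩, ⟨t, ht, h⟩⟩)
    · rw [ray_mem_crossings_iff hp hc hlt]
      exact ⟨p * k - p, by push_cast; ring⟩
    · simp only
      rw [chordPoint_mem_crossings_iff hc hlt _ (abs_le.2 hs)]
      rcases chordPoint_eq hc hlt (abs_le.2 hs) (abs_le.2 ht) h.symm with h1 | h1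
      · exact absurd ((chord_eq_iff hc hlt).2 h1.2) hne
      · exact h1
  · rintro ⟨j, d, h1, h2, rfl⟩
    -- Boundary crossings need no separate case: a scattering point is also the meeting point of two
    -- different paths.
    right
    obtain ⟨k, hk, n, hkn⟩ := exists_lt_eq_mul_add hpq (by omega) j
    obtain ⟨l, hl, m, hlm⟩ := exists_lt_eq_mul_add hpq (by omega) (j + d)
    have hd1 : (1 : ℝ) ≤ d := by exact_mod_cast h1
    have hd2 : (d : ℝ) ≤ p := by exact_mod_cast h2
    refine ⟨k, hk, l, hl, ?_, ?_⟩
    · rw [← chord_add hc (by omega) (p * k) n, ← hkn, ← chord_add hc (by omega) (p * l) m, ← hlm]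
      intro h
      obtain ⟨a, ha⟩ := (chord_eq_iff hc hlt).1 h
      have h3 : (q : ℤ) * a < q * 0 := by omega
      have h4 : (q : ℤ) * (-1) < q * a := by omega
      have h5 := lt_of_mul_lt_mul_left h3 hq.le
      have h6 := lt_of_mul_lt_mul_left h4 hq.le
      omega
    · rw [← chord_add hc (by omega) (p * k) n, ← hkn, ← chord_add hc (by omega) (p * l) m, ← hlm]
      -- The crossing has parameter `d` on chord `j` and `-d` on chord `j + d`.
      refine ⟨⟨d, ⟨by linarith, hd2⟩, rfl⟩, ⟨-d, ⟨by linarith, by linarith⟩, ?_⟩⟩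
      simp only
      rw [polarPoint_neg]
      congr 1
      push_cast
      ring

theorem state_period {p q : ℕ} (hq : 0 < q) {R : ℝ} (hR : 0 < R) {P₀ : ℂ} (hP : ‖P₀‖ = R)
    {ϑ : ℝ} (hϑ : ϑ = (p : ℝ) / q * (2 * Real.pi)) : state R P₀ ϑ q = state R P₀ ϑ 0 := by
  have hq' : (q : ℂ) ≠ 0 := by exact_mod_cast hq.ne'
  have h : Complex.exp ((q * ϑ : ℝ) * Complex.I) = 1 := by
    rw [Complex.exp_eq_one_iff]
    refine ⟨p, ?_⟩
    rw [hϑ]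
    push_cast
    field_simp
  rw [state_eq hR hP, state_eq hR hP, h]
  simp

theorem point_ne {p q : ℕ} (hpq : Nat.gcd p q = 1) {R : ℝ} (hR : 0 < R) {P₀ : ℂ}
    (hP : ‖P₀‖ = R) {ϑ : ℝ} (hϑ : ϑ = (p : ℝ) / q * (2 * Real.pi)) {n : ℕ} (h0 : 0 < n)
    (hn : n < q) : point R P₀ ϑ n ≠ P₀ := by
  have hP0 : P₀ ≠ 0 := norm_pos_iff.1 (hP ▸ hR)
  have hc := mul_ne_zero hP0 (Complex.exp_ne_zero ((ϑ / 2 : ℝ) * Complex.I))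
  intro h
  have h1 : point R P₀ ϑ 0 = P₀ := rfl
  replace h := h.trans h1.symm
  rw [point_eq_ray (by omega) hR hP hϑ, point_eq_ray (by omega) hR hP hϑ,
    ray_eq_ray_iff hc (by omega)] at h
  obtain ⟨m, hm⟩ := h
  have h2 : (p * n : ℤ) = q * m := by
    have : (p : ℝ) * n = q * m := by
      push_cast at hm
      linarith
    exact_mod_cast this
  have h3 : (q : ℤ) ∣ (p * n : ℕ) := ⟨m, by exact_mod_cast h2⟩
  have h4 : q ∣ p * n := by exact_mod_cast h3
  exact absurd (Nat.le_of_dvd h0 ((Nat.Coprime.symm hpq).dvd_of_dvd_mul_left h4)) (by omega)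

end CircularBilliard

theorem mainTheorem3 (p q : ℕ) (hp : 1 ≤ p) (hpq : Nat.gcd p q = 1) (hlt : 2 * p < q)
    (R : ℝ) (hR : 0 < R) (P₀ : ℂ) (hP₀ : ‖P₀‖ = R)
    (ϑ : ℝ) (hϑ : ϑ = (p : ℝ) / (q : ℝ) * (2 * Real.pi)) :
    -- the trajectory closes up after `q` reflections, and not earlier
    (CircularBilliard.state R P₀ ϑ q = CircularBilliard.state R P₀ ϑ 0 ∧
      ∀ n : ℕ, 0 < n → n < q → CircularBilliard.point R P₀ ϑ n ≠ P₀) ∧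
    -- the total number of regions
    CircularBilliard.numRegions R P₀ ϑ q = p * q + 1 ∧
    -- the numbers of edges and of vertices, and Euler's formula
    CircularBilliard.numEdges R P₀ ϑ q = 2 * p * q ∧
    CircularBilliard.numVertices R P₀ ϑ q = p * q ∧
    (CircularBilliard.numRegions R P₀ ϑ q : ℤ) =
      1 + (CircularBilliard.numEdges R P₀ ϑ q : ℤ) -
        (CircularBilliard.numVertices R P₀ ϑ q : ℤ) := by
  have hP0 : P₀ ≠ 0 := norm_pos_iff.1 (hP₀ ▸ hR)
  have hc := mul_ne_zero hP0 (Complex.exp_ne_zero ((ϑ / 2 : ℝ) * Complex.I))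
  have hnorm : ‖P₀ * Complex.exp ((ϑ / 2 : ℝ) * Complex.I)‖ = R := by
    rw [norm_mul, Complex.norm_exp_ofReal_mul_I, mul_one, hP₀]
  have hregions : CircularBilliard.numRegions R P₀ ϑ q = p * q + 1 := by
    rw [CircularBilliard.numRegions, CircularBilliard.trajectory_eq hp hpq hlt hR hP₀ hϑ,
      ← CircularBilliard.card_regions hc hlt, hnorm]
  have hedges : CircularBilliard.numEdges R P₀ ϑ q = 2 * p * q := by
    rw [CircularBilliard.numEdges, CircularBilliard.trajectory_eq hp hpq hlt hR hP₀ hϑ,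
      CircularBilliard.vertices_eq hp hpq hlt hR hP₀ hϑ,
      ← CircularBilliard.card_edges hp hc hlt, hnorm]
  have hvertices : CircularBilliard.numVertices R P₀ ϑ q = p * q := by
    rw [CircularBilliard.numVertices, CircularBilliard.vertices_eq hp hpq hlt hR hP₀ hϑ,
      CircularBilliard.ncard_crossings hc hlt]
  refine ⟨⟨CircularBilliard.state_period (by omega) hR hP₀ hϑ,
    fun n h0 hn => CircularBilliard.point_ne hpq hR hP₀ hϑ h0 hn⟩, hregions, hedges, hvertices, ?_⟩
  rw [hregions, hedges, hvertices]
  push_cast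
  ring
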